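/- Let $M$ be a smooth manifold, $A\to M$ a smooth vector bundle of finite rank, $\Gamma=\Gamma A$ its space of smooth sections, $n\ge 1$, and $\mathcal L=\bigwedge^{n-1}_{\mathbb R}\Gamma$. For $p\ge 1$ let $\mathrm{Der}^p(A)$ be the space of $\mathbb R$-linear maps $D:\mathcal L^{\otimes(p-1)}\otimes(\mathcal L\wedge\Gamma)\to\Gamma$ (tensor and exterior products over $\mathbb R$, $\mathcal L\wedge\Gamma=\bigwedge^n_{\mathbb R}\Gamma$) that have a symbol: an $\mathbb R$-linear map $\sigma_D:\mathcal L^{\otimes p}\to\mathfrak X(M)$ which is $C^\infty(M)$-multilinear in the $n-1$ sections of the last factor and satisfies $$D(X_1,\dots,X_p,fz)=f\,D(X_1,\dots,X_p,z)+\sigma_D(X_1,\dots,X_p)(f)\,z\qquad(f\in C^\infty(M),\ z\in\Gamma).$$ For $D_1\in\mathrm{Der}^p(A)$ and $D_2\in\mathrm{Der}^q(A)$ put $[D_1,D_2]=(-1)^{pq}D_1\circ D_2-D_2\circ D_1$, where, on decomposable $X_i=X_i^1\wedge\dots\wedge X_i^{n-1}$, $$(D_1\circ D_2)(X_1,\dots,X_{p+q},z)=\sum_{k=0}^{p-1}\sum_{\sigma\in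 Sh(k,q)}\mathrm{sgn}(\sigma)(-1)^{kq}\sum_{s=1}^{n-1}D_1\big(X_{\sigma(1)},\dots,X_{\sigma(k)},X_{k+q+1}^{1}\wedge\dots\wedge D_2(X_{\sigma(k+1)},\dots,X_{\sigma(k+q)},X^s_{k+q+1})\wedge\dots\wedge X_{k+q+1}^{n-1},X_{k+q+2},\dots,X_{p+q},z\big)$$ $$\qquad+\sum_{\sigma\in Sh(p,q)}\mathrm{sgn}(\sigma)(-1)^{pq}D_1\big(X_{\sigma(1)},\dots,X_{\sigma(p)},D_2(X_{\sigma(p+1)},\dots,X_{\sigma(p+q)},z)\big).$$ Let a Filippov algebroid structure of order $n$ on $A$ be given by $\varphi\in\mathrm{Der}^1(A)$ with $[\varphi,\varphi]=0$, and put $C^{m}_F(A)=\mathrm{Der}^{m-1}(A)$, $\delta_F=[\varphi,\cdot\,]$ and $H^3_F(A)=\{D\in C^3_F(A):\delta_F D=0\}/\delta_F(C^2_F(A))$. Let $k\ge 0$ and let $\varphi_t=\varphi_0+\sum_{i=1}^k t^i\varphi_i$ with $\varphi_0=\varphi$, $\varphi_i\in\mathrm{Der}^1(A)$, be a deformation of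 order $k$ of $\varphi$, i.e. $\sum_{i+j=r,\ i,j\ge0}[\varphi_i,\varphi_j]=0$ for $r=0,\dots,k$. Theorem. The obstruction cochain $$\Theta_F=-\tfrac12\sum_{i+j=k+1,\ i,j>0}[\varphi_i,\varphi_j]$$ is a $3$-cocycle: $\Theta_F\in C^3_F(A)$ and $\delta_F\Theta_F=0$. Moreover, $\varphi_t$ extends to a deformation of order $k+1$ (that is, there is $\varphi_{k+1}\in C^2_F(A)$ such that $\varphi_t+t^{k+1}\varphi_{k+1}$ is a deformation of order $k+1$) if and only if the class of $\Theta_F$ in $H^3_F(A)$ vanishes. -/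

import Mathlib

open scoped Manifold ContDiff Bundle

noncomputable section

namespace Filippov

/-! ### Cochains and the bracket, over an arbitrary real vector space of sections

In order `n = r + 1`, an element of `⋀^{n-1} Γ` that is decomposable is given by a block
`Fin r → Γ`, and a linear map on `⊗^p (⋀^{n-1} Γ) ⊗ Γ` by its values on `p` blocks and one more
element of `Γ`. Multilinearity and skew symmetry are imposed in `IsMultiderivation` below. -/

section Algebra

variable {Γ : Type*} [AddCommGroup Γ]

/-- Maps of `p` blocks `X₁, …, X_p` (each a tuple of `r` elements) and a last element `z`. -/
abbrev Cochain (r p : ℕ) (Γ : Type*) : Type _ := (Fin p → Fin r → Γ) → Γ → Γ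

/-- The `(k, q)`-shuffles: permutations of `k + q` letters that are increasing on the first `k`
and on the last `q` letters. -/
def shuffles (k q : ℕ) : Finset (Equiv.Perm (Fin (k + q))) :=
  Finset.univ.filter fun σ =>
    (∀ i j : Fin k, i < j → σ (Fin.castAdd q i) < σ (Fin.castAdd q j)) ∧
    (∀ i j : Fin q, i < j → σ (Fin.natAdd k i) < σ (Fin.natAdd k j))

/-- For `k < p`, the map `D₁ ∘_k^σ D₂` without its sign `(-1)^{kq}`: the blocks given to `D₁` are
`X_{σ(1)}, …, X_{σ(k)}`, then the block `X_{k+q+1}` with its `s`-th entry `x` replaced by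
`D₂(X_{σ(k+1)}, …, X_{σ(k+q)}, x)` (summed over `s`), then `X_{k+q+2}, …, X_{p+q}`. -/
def circInner {r p q : ℕ} (D₁ : Cochain r p Γ) (D₂ : Cochain r q Γ) (k : Fin p)
    (σ : Equiv.Perm (Fin (k + q))) : Cochain r (p + q) Γ := fun X z =>
  let Y : Fin (k + q) → Fin r → Γ := fun i => X (Fin.castLE (by omega) (σ i))
  let W : Fin r → Γ := X ⟨k + q, by omega⟩
  ∑ s : Fin r,
    D₁ (fun i : Fin p =>
      if h : i < k then Y (Fin.castAdd q ⟨i, h⟩)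
      else if i = k then Function.update W s (D₂ (fun j => Y (Fin.natAdd k j)) (W s))
      else X ⟨i + q, by omega⟩) z

/-- The map `D₁ ∘_p^σ D₂` without its sign `(-1)^{pq}`. -/
def circLast {r p q : ℕ} (D₁ : Cochain r p Γ) (D₂ : Cochain r q Γ)
    (σ : Equiv.Perm (Fin (p + q))) : Cochain r (p + q) Γ := fun X z =>
  D₁ (fun i => X (σ (Fin.castAdd q i))) (D₂ (fun j => X (σ (Fin.natAdd p j))) z)

/-- The circle product `D₁ ∘ D₂ = ∑_{k ≤ p} ∑_{σ ∈ Sh(k,q)} sgn(σ) D₁ ∘_k^σ D₂`. -/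
def circ {r p q : ℕ} (D₁ : Cochain r p Γ) (D₂ : Cochain r q Γ) : Cochain r (p + q) Γ :=
  fun X z =>
    (∑ k : Fin p, ∑ σ ∈ shuffles k q,
      ((Equiv.Perm.sign σ : ℤ) * (-1) ^ ((k : ℕ) * q)) • circInner D₁ D₂ k σ X z) +
    ∑ σ ∈ shuffles p q, ((Equiv.Perm.sign σ : ℤ) * (-1) ^ (p * q)) • circLast D₁ D₂ σ X z

/-- The bracket `[D₁, D₂] = (-1)^{pq} D₁ ∘ D₂ - D₂ ∘ D₁`. -/
def bracket {r p q : ℕ} (D₁ : Cochain r p Γ) (D₂ : Cochain r q Γ) : Cochain r (p + q) Γ :=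
  fun X z =>
    ((-1 : ℤ) ^ (p * q)) • circ D₁ D₂ X z -
      circ D₂ D₁ (fun i => X (Fin.cast (Nat.add_comm q p) i)) z

end Algebra

/-! ### Sections, vector fields and multiderivations of a smooth vector bundle -/

section Geometry

variable {E : Type*} [NormedAddCommGroup E] [NormedSpace ℝ E]
  {M : Type*} [TopologicalSpace M] [ChartedSpace E M]

/-- Smooth real functions on `M`. -/
abbrev SmoothFn (E : Type*) [NormedAddCommGroup E] [NormedSpace ℝ E]
    (M : Type*) [TopologicalSpace M] [ChartedSpace E M] : Type _ :=
  C^∞⟮𝓘(ℝ, E), M; 𝓘(ℝ, ℝ), ℝ⟯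

/-- Smooth vector fields on `M`, i.e. smooth sections of the tangent bundle. -/
abbrev VectorFields (E : Type*) [NormedAddCommGroup E] [NormedSpace ℝ E]
    (M : Type*) [TopologicalSpace M] [ChartedSpace E M] [IsManifold 𝓘(ℝ, E) ∞ M] : Type _ :=
  Cₛ^∞⟮𝓘(ℝ, E); E, (TangentSpace 𝓘(ℝ, E) : M → Type _)⟯

/-- The derivative `Z(f)` of a smooth function `f` along a vector field `Z`. -/
def lieDeriv [IsManifold 𝓘(ℝ, E) ∞ M] (Z : VectorFields E M) (f : SmoothFn E M) (x : M) : ℝ :=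
  mfderiv 𝓘(ℝ, E) 𝓘(ℝ, ℝ) f x (Z x)

variable (E) (F : Type*) [NormedAddCommGroup F] [NormedSpace ℝ F]
  (V : M → Type*) [∀ x, AddCommGroup (V x)] [∀ x, Module ℝ (V x)]
  [∀ x, TopologicalSpace (V x)] [TopologicalSpace (Bundle.TotalSpace F V)]
  [FiberBundle F V] [VectorBundle ℝ F V]

/-- Smooth sections of the vector bundle `V` (with model fibre `F`). -/
abbrev Sec : Type _ := Cₛ^∞⟮𝓘(ℝ, E); F, V⟯

variable {E F V}

/-- The product of a smooth section by a smooth function. -/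
def fsmul (f : SmoothFn E M) (s : Cₛ^∞⟮𝓘(ℝ, E); F, V⟯) : Cₛ^∞⟮𝓘(ℝ, E); F, V⟯ :=
  ⟨fun x => f x • s x, f.contMDiff.smul_section s.contMDiff⟩

/-- Multilinearity over `ℝ` in all entries of all blocks, and skew symmetry in each block: the
maps that factor through a linear map on `⊗^p (⋀^r Γ)`. -/
structure IsBlockMultilinear {Γ N : Type*} [AddCommGroup Γ] [Module ℝ Γ] [AddCommGroup N]
    [Module ℝ N] {r p : ℕ} (T : (Fin p → Fin r → Γ) → N) : Prop where
  map_add : ∀ (X : Fin p → Fin r → Γ) (i : Fin p) (j : Fin r) (a b : Γ),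
    T (Function.update X i (Function.update (X i) j (a + b))) =
      T (Function.update X i (Function.update (X i) j a)) +
      T (Function.update X i (Function.update (X i) j b))
  map_smul : ∀ (X : Fin p → Fin r → Γ) (i : Fin p) (j : Fin r) (t : ℝ) (a : Γ),
    T (Function.update X i (Function.update (X i) j (t • a))) =
      t • T (Function.update X i (Function.update (X i) j a))
  map_eq_zero : ∀ (X : Fin p → Fin r → Γ) (i : Fin p) (j j' : Fin r),
    j ≠ j' → X i j = X i j' → T X = 0

variable [IsManifold 𝓘(ℝ, E) ∞ M]

/-- `S` is a symbol of `D`: a map to vector fields, `ℝ`-multilinear on blocks and skew symmetric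
in each block, which is `C^∞(M)`-multilinear in the last block and satisfies
`D(X₁, …, X_p, f z) = f D(X₁, …, X_p, z) + S(X₁, …, X_p)(f) z`. For `p = 1` this is
`C^∞(M)`-multilinearity; for `p ≥ 2`, linearity over `C^∞(M)` in `X₁, …, X_{p-1}` is not asked for,
because the bracket does not preserve it. -/
structure IsSymbol {r p : ℕ} (D : Cochain r p (Sec E F V))
    (S : (Fin p → Fin r → Sec E F V) → VectorFields E M) : Prop where
  multilinear : IsBlockMultilinear S
  fsmul_last : ∀ (X : Fin p → Fin r → Sec E F V) (i : Fin p), (i : ℕ) + 1 = p →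
    ∀ (j : Fin r) (f : SmoothFn E M),
      S (Function.update X i (Function.update (X i) j (fsmul f (X i j)))) = fsmul f (S X)
  leibniz : ∀ (X : Fin p → Fin r → Sec E F V) (f : SmoothFn E M) (z : Sec E F V) (x : M),
    D X (fsmul f z) x = f x • D X z x + lieDeriv (S X) f x • z x

/-- Filippov multiderivations of degree `p` in order `r + 1`: maps
`⊗^{p-1} (⋀^r Γ) ⊗ (⋀^{r+1} Γ) → Γ` on sections that have a symbol. For `p = 0` these are the
derivations of the vector bundle. -/
structure IsMultiderivation {r p : ℕ} (D : Cochain r p (Sec E F V)) : Prop where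
  map_add : ∀ X z z', D X (z + z') = D X z + D X z'
  map_smul : ∀ X (t : ℝ) z, D X (t • z) = t • D X z
  multilinear : IsBlockMultilinear D
  /-- skew symmetry of the last block together with the last argument -/
  map_eq_zero : ∀ (X : Fin p → Fin r → Sec E F V) (i : Fin p), (i : ℕ) + 1 = p →
    ∀ j : Fin r, D X (X i j) = 0
  exists_symbol : ∃ S, IsSymbol D S

theorem IsBlockMultilinear.zero {Γ N : Type*} [AddCommGroup Γ] [Module ℝ Γ] [AddCommGroup N]
    [Module ℝ N] {r p : ℕ} : IsBlockMultilinear (0 : (Fin p → Fin r → Γ) → N) :=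
  ⟨by simp, by simp, by simp⟩

theorem IsBlockMultilinear.add {Γ N : Type*} [AddCommGroup Γ] [Module ℝ Γ] [AddCommGroup N]
    [Module ℝ N] {r p : ℕ} {S T : (Fin p → Fin r → Γ) → N} (hS : IsBlockMultilinear S)
    (hT : IsBlockMultilinear T) : IsBlockMultilinear (S + T) where
  map_add X i j a b := by simp only [Pi.add_apply, hS.map_add, hT.map_add]; abel
  map_smul X i j t a := by simp only [Pi.add_apply, hS.map_smul, hT.map_smul, smul_add]
  map_eq_zero X i j j' h h' := by
    simp only [Pi.add_apply, hS.map_eq_zero X i j j' h h', hT.map_eq_zero X i j j' h h', add_zero]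

theorem IsBlockMultilinear.smul {Γ N : Type*} [AddCommGroup Γ] [Module ℝ Γ] [AddCommGroup N]
    [Module ℝ N] {r p : ℕ} {S : (Fin p → Fin r → Γ) → N} (t : ℝ) (hS : IsBlockMultilinear S) :
    IsBlockMultilinear (t • S) where
  map_add X i j a b := by simp only [Pi.smul_apply, hS.map_add, smul_add]
  map_smul X i j t a := by simp only [Pi.smul_apply, hS.map_smul, smul_comm t]
  map_eq_zero X i j j' h h' := by
    simp only [Pi.smul_apply, hS.map_eq_zero X i j j' h h', smul_zero]

variable (E F V)

/-- The space `Der^p` of Filippov multiderivations of degree `p` in order `r + 1`; in the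
deformation complex it is the space `C^{p+1}_F` of `(p+1)`-cochains. -/
def Der (r p : ℕ) : Submodule ℝ (Cochain r p (Sec E F V)) where
  carrier := {D | IsMultiderivation D}
  zero_mem' := ⟨by simp, by simp, IsBlockMultilinear.zero, by simp, 0,
    IsBlockMultilinear.zero, by
      intro X i _ j f; ext x; simp [fsmul], by
      intro X f z x
      have e : lieDeriv ((0 : (Fin p → Fin r → Sec E F V) → VectorFields E M) X) f x = 0 :=
        map_zero (mfderiv 𝓘(ℝ, E) 𝓘(ℝ, ℝ) f x)
      rw [e, zero_smul]; simp⟩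
  add_mem' := by
    rintro D D' h h'
    obtain ⟨S, hS⟩ := h.exists_symbol
    obtain ⟨S', hS'⟩ := h'.exists_symbol
    refine ⟨?_, ?_, h.multilinear.add h'.multilinear, ?_, S + S',
      hS.multilinear.add hS'.multilinear, ?_, ?_⟩
    · intro X z z'
      simp only [Pi.add_apply, h.map_add, h'.map_add]; abel
    · intro X t z
      simp only [Pi.add_apply, h.map_smul, h'.map_smul, smul_add]
    · intro X i hi j
      simp only [Pi.add_apply, h.map_eq_zero X i hi j, h'.map_eq_zero X i hi j, add_zero]
    · intro X i hi j f
      ext x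
      simp only [Pi.add_apply, hS.fsmul_last X i hi j f, hS'.fsmul_last X i hi j f]
      simp [fsmul]
    · intro X f z x
      have e : lieDeriv ((S + S') X) f x = lieDeriv (S X) f x + lieDeriv (S' X) f x :=
        map_add (mfderiv 𝓘(ℝ, E) 𝓘(ℝ, ℝ) f x) (S X x) (S' X x)
      rw [e]
      simp only [Pi.add_apply, ContMDiffSection.coe_add, hS.leibniz, hS'.leibniz, add_smul,
        smul_add]
      abel
  smul_mem' := by
    rintro t D h
    obtain ⟨S, hS⟩ := h.exists_symbol
    refine ⟨?_, ?_, h.multilinear.smul t, ?_, t • S, hS.multilinear.smul t, ?_, ?_⟩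
    · intro X z z'
      simp only [Pi.smul_apply, h.map_add, smul_add]
    · intro X u z
      simp only [Pi.smul_apply, h.map_smul, smul_comm t]
    · intro X i hi j
      simp only [Pi.smul_apply, h.map_eq_zero X i hi j, smul_zero]
    · intro X i hi j f
      ext x
      simp only [Pi.smul_apply, hS.fsmul_last X i hi j f]
      simp [fsmul, smul_comm t]
    · intro X f z x
      have e : lieDeriv ((t • S) X) f x = t * lieDeriv (S X) f x :=
        map_smul (mfderiv 𝓘(ℝ, E) 𝓘(ℝ, ℝ) f x) t (S X x)
      rw [e]
      simp only [Pi.smul_apply, ContMDiffSection.coe_smul, hS.leibniz, smul_add, mul_smul,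
        smul_comm t]

variable {E F V}

theorem circInner_one {r q : ℕ} {Γ : Type*} [AddCommGroup Γ] (D₁ : Cochain r 1 Γ)
    (D₂ : Cochain r q Γ) (k : Fin 1) (σ : Equiv.Perm (Fin (k + q))) (X : Fin (1 + q) → Fin r → Γ)
    (z : Γ) :
    circInner D₁ D₂ k σ X z = ∑ s : Fin r,
      D₁ (Function.update (fun _ => X ⟨k + q, by omega⟩) k
        (Function.update (X ⟨k + q, by omega⟩) s
          (D₂ (fun j => X (Fin.castLE (by omega) (σ (Fin.natAdd k j))))
            (X ⟨k + q, by omega⟩ s)))) z := by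
  unfold circInner
  refine Finset.sum_congr rfl fun s _ => congrFun (congrArg D₁ (funext fun i => ?_)) z
  obtain rfl : i = k := Subsingleton.elim _ _
  simp

theorem circ_add_right {r p : ℕ} (φ : Der E F V r 1) (D D' : Cochain r p (Sec E F V)) :
    circ φ.1 (D + D') = circ φ.1 D + circ φ.1 D' := by
  have h : IsMultiderivation φ.1 := φ.2
  have h1 := fun X i j a b z => congrFun (h.multilinear.map_add X i j a b) z
  funext X z
  simp only [Pi.add_apply] at h1 ⊢
  simp only [circ, circInner_one, circLast, Pi.add_apply, h.map_add, h1, smul_add,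
    Finset.sum_add_distrib]
  abel

theorem circ_smul_right {r p : ℕ} (φ : Der E F V r 1) (t : ℝ) (D : Cochain r p (Sec E F V)) :
    circ φ.1 (t • D) = t • circ φ.1 D := by
  have h : IsMultiderivation φ.1 := φ.2
  have h1 := fun X i j a b z => congrFun (h.multilinear.map_smul X i j a b) z
  funext X z
  simp only [Pi.smul_apply] at h1 ⊢
  simp only [circ, circInner_one, circLast, Pi.smul_apply, h.map_smul, h1,
    smul_add, Finset.smul_sum]
  simp only [smul_comm t]

theorem circ_add_left {r p q : ℕ} {Γ : Type*} [AddCommGroup Γ] (D D' : Cochain r p Γ)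
    (D₂ : Cochain r q Γ) : circ (D + D') D₂ = circ D D₂ + circ D' D₂ := by
  funext X z
  simp only [circ, circInner, circLast, Pi.add_apply, smul_add, Finset.sum_add_distrib]
  abel

theorem circ_smul_left {r p q : ℕ} {Γ : Type*} [AddCommGroup Γ] [Module ℝ Γ] (t : ℝ)
    (D : Cochain r p Γ) (D₂ : Cochain r q Γ) : circ (t • D) D₂ = t • circ D D₂ := by
  funext X z
  simp only [circ, circInner, circLast, Pi.smul_apply, smul_add, Finset.smul_sum]
  simp only [smul_comm t]

/-- The differential `δ_F = [φ, ·]`. -/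
def delta {r p : ℕ} (φ : Der E F V r 1) :
    Cochain r p (Sec E F V) →ₗ[ℝ] Cochain r (1 + p) (Sec E F V) where
  toFun D := bracket φ.1 D
  map_add' D D' := by
    funext X z
    simp only [bracket, circ_add_right, circ_add_left, Pi.add_apply, smul_add]
    abel
  map_smul' t D := by
    funext X z
    simp only [bracket, circ_smul_right, circ_smul_left, Pi.smul_apply, smul_sub,
      RingHom.id_apply, smul_comm t]

/-- The cocycles of degree `p` of `Der^*`, i.e. the `(p+1)`-cocycles of the deformation complex. -/
def cocycles {r : ℕ} (φ : Der E F V r 1) (p : ℕ) : Submodule ℝ (Cochain r p (Sec E F V)) :=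
  Der E F V r p ⊓ LinearMap.ker (delta φ)

/-- The coboundaries `δ_F(Der^p)`, i.e. the `(p+2)`-coboundaries of the deformation complex. -/
def coboundaries {r : ℕ} (φ : Der E F V r 1) (p : ℕ) :
    Submodule ℝ (Cochain r (1 + p) (Sec E F V)) :=
  (Der E F V r p).map (delta φ)

/-- The cohomology `H^{p+2}_F` of the deformation complex: `(p+2)`-cocycles modulo
`(p+2)`-coboundaries. -/
abbrev Cohomology {r : ℕ} (φ : Der E F V r 1) (p : ℕ) : Type _ :=
  cocycles φ (1 + p) ⧸ (coboundaries φ p).comap (cocycles φ (1 + p)).subtype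

/-- `φ_t = ∑_{i ≤ k} t^i c_i` is a deformation of order `k` of `φ`: `c_0 = φ` and
`[φ_t, φ_t] = 0` modulo `t^{k+1}`. The values `c_i` with `i > k` play no role. -/
structure IsDeformation {r : ℕ} (φ : Der E F V r 1) (k : ℕ) (c : ℕ → Der E F V r 1) : Prop where
  zero : c 0 = φ
  bracket_eq : ∀ m ≤ k, ∑ ij ∈ Finset.HasAntidiagonal.antidiagonal m, bracket (c ij.1).1 (c ij.2).1 = 0

/-- The deformation `∑_{i ≤ k} t^i c_i` extends to a deformation `∑_{i ≤ k} t^i c_i + t^{k+1} ψ`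
of order `k + 1`. -/
def Extends {r : ℕ} (φ : Der E F V r 1) (k : ℕ) (c : ℕ → Der E F V r 1) : Prop :=
  ∃ ψ : Der E F V r 1, IsDeformation φ (k + 1) (Function.update c (k + 1) ψ)

/-- The obstruction cochain `Θ_F = -1/2 ∑_{i+j=k+1, i,j>0} [c_i, c_j]`. -/
def obstruction {r : ℕ} (k : ℕ) (c : ℕ → Der E F V r 1) : Cochain r (1 + 1) (Sec E F V) :=
  (-1 / 2 : ℝ) • ∑ ij ∈ (Finset.HasAntidiagonal.antidiagonal (k + 1)).filter (fun ij => 0 < ij.1 ∧ 0 < ij.2),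
    bracket (c ij.1).1 (c ij.2).1

end Geometry

end Filippov

end

/-! ### Vector fields: derivations of smooth functions and the Lie bracket -/

namespace Filippov

/-! The theorem is the standard obstruction argument in a graded Lie algebra, and only brackets of
degrees (1,1) and (1,2) enter. A cochain of degree 1 is an alternating map from blocks to
`Module.End ℝ Γ`. In this form the bracket is built from products of endomorphisms and the
derivation action `derivAlong`; it is symmetric in degree 1, and the cyclic Jacobi identity
`bracketAlt_jacobi` is a computation in a noncommutative ring.

Let `B m` be the coefficient of `t^m` in `[φ_t, φ_t]` (`bracketCoeff`). Jacobi gives `∑ [c_i, B_j] =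
0` over `i + j = k + 1`. Since `B_j = 0` for `j ≤ k`, only `[φ, B_{k+1}] = 0` remains. Appending `ψ`
as coefficient of `t^{k+1}` gives `B_{k+1} = 2 (δψ - Θ)` (`bracketCoeff_update_succ`). Taking `ψ =
0` shows that `Θ` is closed; solving `B_{k+1} = 0` for `ψ` is the equation `δψ = Θ`.

The geometric part is that `Θ` is a cochain, i.e. that the bracket of two multiderivations of degree
1 has a symbol (`bracket_mem_der`). The bracket regroups into `derivAlong` terms and commutators of
first order operators, whose symbols are Lie brackets of vector fields. In the last block, the
failures of these two kinds of terms to be `C^∞(M)`-linear cancel. -/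

theorem two_le_infty : (2 : ℕ∞ω) ≤ ∞ := by
  exact WithTop.coe_le_coe.2 (le_top : (2 : ℕ∞) ≤ ⊤)

theorem fsmul_apply {E : Type*} [NormedAddCommGroup E] [NormedSpace ℝ E]
    {M : Type*} [TopologicalSpace M] [ChartedSpace E M] {F : Type*} [NormedAddCommGroup F] [NormedSpace ℝ F]
    {V : M → Type*} [∀ x, AddCommGroup (V x)] [∀ x, Module ℝ (V x)]
    [∀ x, TopologicalSpace (V x)] [TopologicalSpace (Bundle.TotalSpace F V)]
    [FiberBundle F V] [VectorBundle ℝ F V] (f : SmoothFn E M) (s : Sec E F V) (x : M) :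
    fsmul f s x = f x • s x := rfl

section VectorFields

variable {E : Type*} [NormedAddCommGroup E] [NormedSpace ℝ E]
  {M : Type*} [TopologicalSpace M] [ChartedSpace E M] [IsManifold 𝓘(ℝ, E) ∞ M]

theorem lieDeriv_eq_mvfderiv (Z : VectorFields E M) (f : SmoothFn E M) (x : M) :
    lieDeriv Z f x = mvfderiv 𝓘(ℝ, E) f x (Z x) := rfl

/-- `Z(f)` is the fibre component of the tangent map of `f` composed with the section `Z`. -/
theorem contMDiff_lieDeriv (Z : VectorFields E M) (f : SmoothFn E M) :
    ContMDiff 𝓘(ℝ, E) 𝓘(ℝ, ℝ) ∞ (lieDeriv Z f) :=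
  (contMDiff_snd_tangentBundle_modelSpace ℝ 𝓘(ℝ, ℝ)).comp
    ((f.contMDiff.contMDiff_tangentMap (m := ∞) (by simp)).comp Z.contMDiff)

/-- The derivative `Z(f)` as a smooth function. -/
noncomputable def lieDerivFn (Z : VectorFields E M) (f : SmoothFn E M) : SmoothFn E M :=
  ⟨lieDeriv Z f, contMDiff_lieDeriv Z f⟩

@[simp]
theorem lieDerivFn_apply (Z : VectorFields E M) (f : SmoothFn E M) (x : M) :
    lieDerivFn Z f x = lieDeriv Z f x := rfl

theorem lieDeriv_add_left (Z Z' : VectorFields E M) (f : SmoothFn E M) (x : M) :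
    lieDeriv (Z + Z') f x = lieDeriv Z f x + lieDeriv Z' f x :=
  map_add (mvfderiv 𝓘(ℝ, E) f x) (Z x) (Z' x)

theorem lieDeriv_neg_left (Z : VectorFields E M) (f : SmoothFn E M) (x : M) :
    lieDeriv (-Z) f x = -lieDeriv Z f x :=
  map_neg (mvfderiv 𝓘(ℝ, E) f x) (Z x)

theorem mdifferentiableAt_vectorField (Z : VectorFields E M) (x : M) :
    MDifferentiableAt 𝓘(ℝ, E) 𝓘(ℝ, E).tangent
      (fun y => (⟨y, Z y⟩ : TangentBundle 𝓘(ℝ, E) M)) x :=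
  Z.contMDiff.mdifferentiableAt (by simp)

theorem lieDeriv_of_apply_eq_zero (Z : VectorFields E M) (f : SmoothFn E M) {x : M}
    (h : Z x = 0) : lieDeriv Z f x = 0 := by
  rw [lieDeriv_eq_mvfderiv, h, map_zero]

variable [CompleteSpace E]

/-- The Lie bracket of smooth vector fields, as a bilinear map. -/
noncomputable def vfBracket : VectorFields E M →ₗ[ℝ] VectorFields E M →ₗ[ℝ] VectorFields E M :=
  haveI : IsManifold 𝓘(ℝ, E) (minSmoothness ℝ 2) M := by
    rw [minSmoothness_of_isRCLikeNormedField]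
    exact IsManifold.of_le (n := ∞) two_le_infty
  haveI : IsManifold 𝓘(ℝ, E) 2 M := IsManifold.of_le (n := ∞) two_le_infty
  haveI : IsManifold 𝓘(ℝ, E) (((⊤ : ℕ∞) : WithTop ℕ∞) + 1) M := by
    simpa using (inferInstance : IsManifold 𝓘(ℝ, E) ∞ M)
  LinearMap.mk₂ ℝ
    (fun Z Z' => ⟨VectorField.mlieBracket 𝓘(ℝ, E) Z Z', fun x =>
      (Z.contMDiff x).mlieBracket_vectorField (n := ⊤) (m := ⊤) (Z'.contMDiff x) (by
        rw [minSmoothness_of_isRCLikeNormedField]; simp)⟩)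
    (fun Z₁ Z₂ Z' => by
      ext x
      exact VectorField.mlieBracket_add_left (mdifferentiableAt_vectorField Z₁ x)
        (mdifferentiableAt_vectorField Z₂ x))
    (fun t Z Z' => by
      ext x
      exact VectorField.mlieBracket_const_smul_left (mdifferentiableAt_vectorField Z x))
    (fun Z Z₁ Z₂ => by
      ext x
      exact VectorField.mlieBracket_add_right (mdifferentiableAt_vectorField Z₁ x)
        (mdifferentiableAt_vectorField Z₂ x))
    (fun t Z Z' => by
      ext x
      exact VectorField.mlieBracket_const_smul_right (mdifferentiableAt_vectorField Z' x))

theorem vfBracket_fsmul_right (Z Z' : VectorFields E M) (f : SmoothFn E M) :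
    vfBracket Z (fsmul f Z') = fsmul (lieDerivFn Z f) Z' + fsmul f (vfBracket Z Z') := by
  have : IsManifold 𝓘(ℝ, E) 2 M := IsManifold.of_le (n := ∞) two_le_infty
  ext x
  exact VectorField.mlieBracket_smul_right (f.contMDiff.mdifferentiableAt (by simp))
    (mdifferentiableAt_vectorField Z' x)

theorem vfBracket_leibniz (U Z W : VectorFields E M) :
    vfBracket U (vfBracket Z W) = vfBracket (vfBracket U Z) W + vfBracket Z (vfBracket U W) := by
  have : IsManifold 𝓘(ℝ, E) (minSmoothness ℝ 3) M := by
    rw [minSmoothness_of_isRCLikeNormedField]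
    exact IsManifold.of_le (n := ∞) (WithTop.coe_le_coe.2 (le_top : (3 : ℕ∞) ≤ ⊤))
  have h : minSmoothness ℝ 2 ≤ ∞ := by
    rw [minSmoothness_of_isRCLikeNormedField]; exact two_le_infty
  ext x
  exact VectorField.leibniz_identity_mlieBracket_apply ((U.contMDiff x).of_le h)
    ((Z.contMDiff x).of_le h) ((W.contMDiff x).of_le h)

/-- The derivation along `[Z, Z']` is the commutator of the derivations along `Z` and `Z'`. -/
theorem lieDeriv_vfBracket (Z Z' : VectorFields E M) (f : SmoothFn E M) (x : M) :
    lieDeriv (vfBracket Z Z') f x =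
      lieDeriv Z (lieDerivFn Z' f) x - lieDeriv Z' (lieDerivFn Z f) x := by
  -- Expanding the Leibniz form of the Jacobi identity on `Z`, `Z'`, `fW` leaves the claim
  -- multiplied by `W x`.
  have key : ∀ W : VectorFields E M, lieDeriv (vfBracket Z Z') f x • W x =
      (lieDeriv Z (lieDerivFn Z' f) x - lieDeriv Z' (lieDerivFn Z f) x) • W x := by
    intro W
    have h := congrArg (fun S : VectorFields E M => S x) (vfBracket_leibniz Z Z' (fsmul f W))
    simp only [vfBracket_fsmul_right, vfBracket_leibniz Z Z' W, map_add, ContMDiffSection.coe_add,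
      Pi.add_apply, fsmul_apply, lieDerivFn_apply, smul_add] at h
    rw [sub_smul, eq_sub_iff_add_eq]
    have h2 := sub_eq_zero.2 h
    rw [← sub_eq_zero, ← neg_eq_zero, ← h2]
    abel
  -- A nonzero value of `Z` or `Z'` at `x` serves as `W x`, so no auxiliary field is needed. If both
  -- vanish at `x`, so does their Lie bracket.
  by_cases hZ : Z x = 0
  · by_cases hZ' : Z' x = 0
    · rw [lieDeriv_of_apply_eq_zero _ _ hZ, lieDeriv_of_apply_eq_zero _ _ hZ', sub_zero,
        lieDeriv_of_apply_eq_zero]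
      have h := VectorField.mlieBracketWithin_eq_zero_of_eq_zero (I := 𝓘(ℝ, E)) (s := Set.univ)
        hZ hZ'
      rwa [VectorField.mlieBracketWithin_univ] at h
    · exact smul_left_injective ℝ hZ' (key Z')
  · exact smul_left_injective ℝ hZ (key Z)

end VectorFields

/-! ### Alternating maps with values in endomorphisms -/

section Alternating

variable {Γ N N₁ N₂ N₃ : Type*} [AddCommGroup Γ] [Module ℝ Γ] [AddCommGroup N] [Module ℝ N]
  [AddCommGroup N₁] [Module ℝ N₁] [AddCommGroup N₂] [Module ℝ N₂] [AddCommGroup N₃] [Module ℝ N₃]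
  {r : ℕ}

theorem altSum_apply {ι : Type*} (s : Finset ι) (f : ι → Γ [⋀^Fin r]→ₗ[ℝ] N) (W : Fin r → Γ) :
    (∑ i ∈ s, f i) W = ∑ i ∈ s, f i W := by
  classical
  induction s using Finset.induction_on with
  | empty => simp
  | insert i s hi h => rw [Finset.sum_insert hi, Finset.sum_insert hi, AlternatingMap.add_apply, h]

/-- The right action of the endomorphisms of `Γ` on alternating maps by derivations:
`derivAlong A T W = ∑ s, A (W₁, …, T W_s, …, W_r)`. -/
noncomputable def derivAlong (A : Γ [⋀^Fin r]→ₗ[ℝ] N) :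
    Module.End ℝ Γ →ₗ[ℝ] Γ [⋀^Fin r]→ₗ[ℝ] N where
  toFun T :=
    { toFun := fun W => ∑ s, A (Function.update W s (T (W s)))
      map_update_add' := by
        intro _ W i x y
        obtain rfl : ‹DecidableEq (Fin r)› = instDecidableEqFin r := Subsingleton.elim _ _
        rw [← Finset.sum_add_distrib]
        refine Finset.sum_congr rfl fun s _ => ?_
        rcases eq_or_ne s i with rfl | h
        · simp
        · simp [Function.update_of_ne h, Function.update_comm h.symm]
      map_update_smul' := by
        intro _ W i t x
        obtain rfl : ‹DecidableEq (Fin r)› = instDecidableEqFin r := Subsingleton.elim _ _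
        rw [Finset.smul_sum]
        refine Finset.sum_congr rfl fun s _ => ?_
        rcases eq_or_ne s i with rfl | h
        · simp
        · simp [Function.update_of_ne h, Function.update_comm h.symm]
      map_eq_zero_of_eq' := by
        intro W i j h hij
        -- Replacing any other entry leaves the equal entries `i`, `j` in place, so that term is
        -- zero; the two remaining terms differ by a transposition.
        rw [Finset.sum_eq_add i j hij]
        · have e : Function.update W j (T (W j)) =
              Function.update W i (T (W i)) ∘ Equiv.swap i j := by
            funext l
            rcases eq_or_ne l i with rfl | hl
            · simp [hij, hij.symm, h]
            · rcases eq_or_ne l j with rfl | hl'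
              · simp [h]
              · simp [Equiv.swap_apply_of_ne_of_ne hl hl', hl, hl']
          rw [e, A.map_swap _ hij, add_neg_cancel]
        · intro s _ hs
          exact A.map_eq_zero_of_eq _
            (by rw [Function.update_of_ne hs.1.symm, Function.update_of_ne hs.2.symm, h]) hij
        · simp
        · simp }
  map_add' S T := by
    ext W
    simp [Finset.sum_add_distrib]
  map_smul' t T := by
    ext W
    simp [Finset.smul_sum]

theorem derivAlong_apply (A : Γ [⋀^Fin r]→ₗ[ℝ] N) (T : Module.End ℝ Γ) (W : Fin r → Γ) :
    derivAlong A T W = ∑ s, A (Function.update W s (T (W s))) := rfl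

/-- `derivAlong` is a right action of the Lie algebra of endomorphisms. -/
theorem derivAlong_mul (A : Γ [⋀^Fin r]→ₗ[ℝ] N) (S T : Module.End ℝ Γ) (W : Fin r → Γ) :
    derivAlong A (S * T) W = derivAlong A (T * S) W +
      (derivAlong (derivAlong A S) T W - derivAlong (derivAlong A T) S W) := by
  -- In the two iterated actions, replacements in different slots commute and cancel; the diagonal
  -- `s = t` leaves the two products of endomorphisms.
  have key : ∀ s t : Fin r,
      A (Function.update (Function.update W s (T (W s))) t
          (S (Function.update W s (T (W s)) t))) -
        A (Function.update (Function.update W t (S (W t))) s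
          (T (Function.update W t (S (W t)) s))) =
      if s = t then A (Function.update W s ((S * T) (W s))) -
        A (Function.update W s ((T * S) (W s))) else 0 := by
    intro s t
    split_ifs with h
    · subst h; simp
    · rw [Function.update_of_ne (Ne.symm h), Function.update_of_ne h, Function.update_comm h,
        sub_self]
  rw [← sub_eq_iff_eq_add', eq_comm]
  simp only [derivAlong_apply]
  rw [Finset.sum_comm (f := fun s t => A (Function.update (Function.update W s (S (W s))) t
    (T (Function.update W s (S (W s)) t))))]
  simp only [← Finset.sum_sub_distrib, key, Finset.sum_ite_eq, Finset.mem_univ, if_true]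

/-- The map `(X, Y) ↦ B (a X) (b Y)` for alternating maps `a`, `b` and a bilinear map `B`. -/
noncomputable def altPair (B : N₁ →ₗ[ℝ] N₂ →ₗ[ℝ] N₃) (a : Γ [⋀^Fin r]→ₗ[ℝ] N₁)
    (b : Γ [⋀^Fin r]→ₗ[ℝ] N₂) : Γ [⋀^Fin r]→ₗ[ℝ] (Γ [⋀^Fin r]→ₗ[ℝ] N₃) :=
  LinearMap.compAlternatingMap
    { toFun := fun u => (B u).compAlternatingMap b
      map_add' := fun u v => by ext; simp
      map_smul' := fun t u => by ext; simp } a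

/-- The circle product of two cochains of degree `1`, with values in endomorphisms. -/
noncomputable def circAlt (a b : Γ [⋀^Fin r]→ₗ[ℝ] Module.End ℝ Γ) :
    Γ [⋀^Fin r]→ₗ[ℝ] (Γ [⋀^Fin r]→ₗ[ℝ] Module.End ℝ Γ) :=
  (derivAlong a).compAlternatingMap b - altPair (LinearMap.mul ℝ _) a b +
    altPair (LinearMap.mul ℝ _).flip b a

theorem circAlt_apply (a b : Γ [⋀^Fin r]→ₗ[ℝ] Module.End ℝ Γ) (X Y : Fin r → Γ) :
    circAlt a b X Y = derivAlong a (b X) Y - a X * b Y + a Y * b X := rfl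

/-- The bracket of two cochains of degree `1`, with values in endomorphisms. -/
noncomputable def bracketAlt (a b : Γ [⋀^Fin r]→ₗ[ℝ] Module.End ℝ Γ) :
    Γ [⋀^Fin r]→ₗ[ℝ] (Γ [⋀^Fin r]→ₗ[ℝ] Module.End ℝ Γ) :=
  -(circAlt a b + circAlt b a)

theorem bracketAlt_apply (a b : Γ [⋀^Fin r]→ₗ[ℝ] Module.End ℝ Γ) (X Y : Fin r → Γ) :
    bracketAlt a b X Y = -(circAlt a b X Y + circAlt b a X Y) := rfl

/-- Products of first order operators are of second order, but commutators are again of first order;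
this grouping is what gives the bracket a symbol. -/
theorem bracketAlt_apply_eq (a b : Γ [⋀^Fin r]→ₗ[ℝ] Module.End ℝ Γ) (X Y : Fin r → Γ) :
    bracketAlt a b X Y = -(derivAlong a (b X) Y + derivAlong b (a X) Y +
      -(a X * b Y - b Y * a X) + -(b X * a Y - a Y * b X)) := by
  rw [bracketAlt_apply, circAlt_apply, circAlt_apply]
  abel

/-- The bracket of a cochain of degree `1` with a cochain of degree `2`. -/
noncomputable def bracketAltTwo (a : Γ [⋀^Fin r]→ₗ[ℝ] Module.End ℝ Γ)
    (D : Γ [⋀^Fin r]→ₗ[ℝ] (Γ [⋀^Fin r]→ₗ[ℝ] Module.End ℝ Γ)) (X Y Z : Fin r → Γ) :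
    Module.End ℝ Γ :=
  derivAlong a (D X Y) Z + (a X * D Y Z - a Y * D X Z + a Z * D X Y) -
    (derivAlong D (a X) Y Z - derivAlong (D X) (a Y) Z + derivAlong (D Y) (a X) Z +
      (D X Y * a Z - D X Z * a Y + D Y Z * a X))

theorem derivAlong_circAlt_left (b c : Γ [⋀^Fin r]→ₗ[ℝ] Module.End ℝ Γ) (T : Module.End ℝ Γ)
    (Y Z : Fin r → Γ) :
    derivAlong (circAlt b c) T Y Z = derivAlong b (derivAlong c T Y) Z -
      derivAlong b T Y * c Z + b Z * derivAlong c T Y := by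
  simp only [derivAlong_apply (circAlt b c), altSum_apply, circAlt_apply,
    Finset.sum_add_distrib, Finset.sum_sub_distrib, derivAlong_apply c T Y,
    derivAlong_apply b T Y, map_sum, Finset.mul_sum, Finset.sum_mul]

/-- Acting on the inner block produces the iterated action on `b`, to be matched by `derivAlong_mul`
in the Jacobi identity. -/
theorem derivAlong_circAlt_right (b c : Γ [⋀^Fin r]→ₗ[ℝ] Module.End ℝ Γ) (T : Module.End ℝ Γ)
    (X Z : Fin r → Γ) :
    derivAlong (circAlt b c X) T Z = derivAlong (derivAlong b (c X)) T Z -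
      b X * derivAlong c T Z + derivAlong b T Z * c X := by
  simp only [derivAlong_apply (circAlt b c X), circAlt_apply,
    Finset.sum_add_distrib, Finset.sum_sub_distrib, derivAlong_apply c T Z,
    derivAlong_apply b T Z, derivAlong_apply (derivAlong b (c X)), Finset.mul_sum, Finset.sum_mul]

theorem derivAlong_neg_left (A : Γ [⋀^Fin r]→ₗ[ℝ] N) (T : Module.End ℝ Γ) (W : Fin r → Γ) :
    derivAlong (-A) T W = -derivAlong A T W := by
  simp [derivAlong_apply]

theorem derivAlong_add_left (A B : Γ [⋀^Fin r]→ₗ[ℝ] N) (T : Module.End ℝ Γ) (W : Fin r → Γ) :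
    derivAlong (A + B) T W = derivAlong A T W + derivAlong B T W := by
  simp [derivAlong_apply, Finset.sum_add_distrib]

theorem derivAlong_bracketAlt_left (b c : Γ [⋀^Fin r]→ₗ[ℝ] Module.End ℝ Γ) (T : Module.End ℝ Γ)
    (Y Z : Fin r → Γ) :
    derivAlong (bracketAlt b c) T Y Z =
      -(derivAlong (circAlt b c) T Y Z + derivAlong (circAlt c b) T Y Z) := by
  rw [bracketAlt, derivAlong_neg_left, derivAlong_add_left]; rfl

theorem derivAlong_bracketAlt_right (b c : Γ [⋀^Fin r]→ₗ[ℝ] Module.End ℝ Γ)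
    (T : Module.End ℝ Γ) (X Z : Fin r → Γ) :
    derivAlong (bracketAlt b c X) T Z =
      -(derivAlong (circAlt b c X) T Z + derivAlong (circAlt c b X) T Z) := by
  rw [← derivAlong_add_left, ← derivAlong_neg_left]; rfl

theorem bracketAlt_jacobi (a b c : Γ [⋀^Fin r]→ₗ[ℝ] Module.End ℝ Γ) (X Y Z : Fin r → Γ) :
    bracketAltTwo a (bracketAlt b c) X Y Z + bracketAltTwo b (bracketAlt c a) X Y Z +
      bracketAltTwo c (bracketAlt a b) X Y Z = 0 := by
  simp only [bracketAltTwo, derivAlong_bracketAlt_left, derivAlong_bracketAlt_right,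
    derivAlong_circAlt_left, derivAlong_circAlt_right, bracketAlt_apply, circAlt_apply, map_neg,
    map_add, map_sub, AlternatingMap.neg_apply, AlternatingMap.add_apply, AlternatingMap.sub_apply]
  -- The action of each commutator such as `b X * c Y - c Y * b X` becomes a difference of iterated
  -- actions; all remaining words then cancel formally.
  rw [derivAlong_mul a (b X) (c Y), derivAlong_mul a (b Y) (c X),
    derivAlong_mul b (c X) (a Y), derivAlong_mul b (c Y) (a X),
    derivAlong_mul c (a X) (b Y), derivAlong_mul c (a Y) (b X)]
  simp only [mul_neg, neg_mul, mul_add, add_mul, mul_sub, sub_mul, mul_assoc]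
  abel

end Alternating

/-! ### The bracket in degrees one and two -/

section LowDegree

variable {Γ : Type*} [AddCommGroup Γ] [Module ℝ Γ] {r : ℕ}

/-- The cochain of degree `1` given by an alternating map with values in endomorphisms. -/
def ofAlt (a : Γ [⋀^Fin r]→ₗ[ℝ] Module.End ℝ Γ) : Cochain r 1 Γ := fun X z => a (X 0) z

/-- The cochain of degree `2` given by an alternating map of alternating maps with values in
endomorphisms. -/
def ofAltTwo (D : Γ [⋀^Fin r]→ₗ[ℝ] (Γ [⋀^Fin r]→ₗ[ℝ] Module.End ℝ Γ)) : Cochain r (1 + 1) Γ :=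
  fun X z => D (X 0) (X 1) z

theorem shuffles_zero_one : shuffles 0 1 = {1} := by decide

theorem shuffles_one_one : shuffles 1 1 = {1, Equiv.swap 0 1} := by decide

theorem shuffles_zero_two : shuffles 0 (1 + 1) = {1} := by decide

theorem shuffles_one_two :
    shuffles 1 (1 + 1) = {1, Equiv.swap 0 1, Equiv.swap 1 2 * Equiv.swap 0 1} := by decide

theorem shuffles_two_one :
    shuffles (1 + 1) 1 = {1, Equiv.swap 1 2, Equiv.swap 0 1 * Equiv.swap 1 2} := by decide

/-- The `k = 0` term is the derivation action; the two (1,1)-shuffles, with the sign `(-1)^{pq} =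
-1`, give the two products. -/
theorem circ_ofAlt (a b : Γ [⋀^Fin r]→ₗ[ℝ] Module.End ℝ Γ) :
    circ (ofAlt a) (ofAlt b) = ofAltTwo (circAlt a b) := by
  funext X z
  unfold circ
  rw [Fin.sum_univ_one, shuffles_one_one]
  -- The index `k : Fin 1` must be reduced to the literal `0` for the explicit list of shuffles to
  -- apply.
  change (∑ σ ∈ shuffles 0 1, _) + _ = _
  rw [shuffles_zero_one, Finset.sum_singleton, Finset.sum_pair (by decide)]
  simp [circInner, circLast, ofAlt, ofAltTwo, circAlt_apply, derivAlong_apply]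
  abel

theorem circ_ofAlt_ofAltTwo (a : Γ [⋀^Fin r]→ₗ[ℝ] Module.End ℝ Γ)
    (D : Γ [⋀^Fin r]→ₗ[ℝ] (Γ [⋀^Fin r]→ₗ[ℝ] Module.End ℝ Γ)) (X : Fin (1 + (1 + 1)) → Fin r → Γ)
    (z : Γ) :
    circ (ofAlt a) (ofAltTwo D) X z = (derivAlong a (D (X 0) (X 1)) (X 2) +
      (a (X 0) * D (X 1) (X 2) - a (X 1) * D (X 0) (X 2) + a (X 2) * D (X 0) (X 1))) z := by
  unfold circ
  rw [Fin.sum_univ_one, shuffles_one_two]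
  change (∑ σ ∈ shuffles 0 (1 + 1), _) + _ = _
  rw [shuffles_zero_two, Finset.sum_singleton, Finset.sum_insert (by decide), Finset.sum_pair (by decide)]
  have h1 : Equiv.swap 0 1 (2 : Fin (1 + (1 + 1))) = 2 := by decide
  have h2 : Equiv.swap 1 2 (0 : Fin (1 + (1 + 1))) = 0 := by decide
  simp [circInner, circLast, ofAlt, ofAltTwo, derivAlong_apply, h1, h2]
  abel


/-- `k = 0` inserts into the block `X 1`; `k = 1` inserts into `X 2`, with two (1,1)-shuffles and
sign `-1`; the three (2,1)-shuffles give the products. -/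
theorem circ_ofAltTwo_ofAlt (a : Γ [⋀^Fin r]→ₗ[ℝ] Module.End ℝ Γ)
    (D : Γ [⋀^Fin r]→ₗ[ℝ] (Γ [⋀^Fin r]→ₗ[ℝ] Module.End ℝ Γ)) (X : Fin (1 + 1 + 1) → Fin r → Γ)
    (z : Γ) :
    circ (ofAltTwo D) (ofAlt a) X z =
      (derivAlong D (a (X 0)) (X 1) (X 2) - derivAlong (D (X 0)) (a (X 1)) (X 2) +
        derivAlong (D (X 1)) (a (X 0)) (X 2) +
      (D (X 0) (X 1) * a (X 2) - D (X 0) (X 2) * a (X 1) + D (X 1) (X 2) * a (X 0))) z := by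
  unfold circ
  rw [Fin.sum_univ_two, shuffles_two_one]
  change (∑ σ ∈ shuffles 0 1, _) + (∑ σ ∈ shuffles 1 1, _) + _ = _
  rw [shuffles_zero_one, shuffles_one_one, Finset.sum_singleton, Finset.sum_pair (by decide), Finset.sum_insert (by decide), Finset.sum_pair (by decide)]
  have h1 : Equiv.swap 0 1 (2 : Fin (1 + 1 + 1)) = 2 := by decide
  have h2 : Equiv.swap 1 2 (0 : Fin (1 + 1 + 1)) = 0 := by decide
  simp [circInner, circLast, ofAlt, ofAltTwo, derivAlong_apply, h1, h2, altSum_apply]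
  abel


theorem bracket_ofAlt (a b : Γ [⋀^Fin r]→ₗ[ℝ] Module.End ℝ Γ) :
    bracket (ofAlt a) (ofAlt b) = ofAltTwo (bracketAlt a b) := by
  funext X z
  have h : (fun i => X (Fin.cast (Nat.add_comm 1 1) i)) = X := rfl
  simp only [bracket, circ_ofAlt, h, ofAltTwo, bracketAlt_apply, mul_one, pow_one, neg_smul,
    one_smul, LinearMap.neg_apply, LinearMap.add_apply]
  abel

theorem bracket_ofAlt_ofAltTwo (a : Γ [⋀^Fin r]→ₗ[ℝ] Module.End ℝ Γ)
    (D : Γ [⋀^Fin r]→ₗ[ℝ] (Γ [⋀^Fin r]→ₗ[ℝ] Module.End ℝ Γ)) (X : Fin (1 + (1 + 1)) → Fin r → Γ)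
    (z : Γ) :
    bracket (ofAlt a) (ofAltTwo D) X z = bracketAltTwo a D (X 0) (X 1) (X 2) z := by
  simp only [bracket, circ_ofAlt_ofAltTwo, circ_ofAltTwo_ofAlt]
  norm_num [bracketAltTwo]

theorem bracket_ofAlt_comm (a b : Γ [⋀^Fin r]→ₗ[ℝ] Module.End ℝ Γ) :
    bracket (ofAlt a) (ofAlt b) = bracket (ofAlt b) (ofAlt a) := by
  rw [bracket_ofAlt, bracket_ofAlt, bracketAlt, bracketAlt, add_comm (circAlt a b)]

/-- The graded Jacobi identity in degree `1`. -/
theorem bracket_ofAlt_jacobi (a b c : Γ [⋀^Fin r]→ₗ[ℝ] Module.End ℝ Γ) :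
    bracket (ofAlt a) (bracket (ofAlt b) (ofAlt c)) +
      bracket (ofAlt b) (bracket (ofAlt c) (ofAlt a)) +
      bracket (ofAlt c) (bracket (ofAlt a) (ofAlt b)) = 0 := by
  funext X z
  simp only [bracket_ofAlt, Pi.add_apply, bracket_ofAlt_ofAltTwo]
  exact congrArg (fun T : Module.End ℝ Γ => T z) (bracketAlt_jacobi a b c (X 0) (X 1) (X 2))

/-- Both sides run over triples of sum `n`, matched by a cyclic rotation. This makes the three terms
of the Jacobi identity contribute equally. -/
theorem sum_antidiagonal_antidiagonal_rotate {A : Type*} [AddCommMonoid A] (n : ℕ)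
    (t : ℕ → ℕ → ℕ → A) :
    ∑ p ∈ Finset.HasAntidiagonal.antidiagonal n, ∑ q ∈ Finset.HasAntidiagonal.antidiagonal p.2, t q.1 q.2 p.1 =
      ∑ p ∈ Finset.HasAntidiagonal.antidiagonal n, ∑ q ∈ Finset.HasAntidiagonal.antidiagonal p.2, t p.1 q.1 q.2 := by
  rw [Finset.sum_sigma', Finset.sum_sigma']
  refine Finset.sum_nbij' (fun x => ⟨(x.2.1, x.2.2 + x.1.1), (x.2.2, x.1.1)⟩)
    (fun x => ⟨(x.2.2, x.1.1 + x.2.1), (x.1.1, x.2.1)⟩) ?_ ?_ ?_ ?_ ?_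
  · rintro ⟨⟨i, j⟩, ⟨a, b⟩⟩ h
    simp only [Finset.mem_sigma, Finset.HasAntidiagonal.mem_antidiagonal] at h ⊢
    exact ⟨show a + (b + i) = n by omega, trivial⟩
  · rintro ⟨⟨i, j⟩, ⟨a, b⟩⟩ h
    simp only [Finset.mem_sigma, Finset.HasAntidiagonal.mem_antidiagonal] at h ⊢
    exact ⟨show b + (i + a) = n by omega, trivial⟩
  · rintro ⟨⟨i, j⟩, ⟨a, b⟩⟩ h
    simp only [Finset.mem_sigma, Finset.HasAntidiagonal.mem_antidiagonal] at h
    obtain ⟨-, rfl⟩ := h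
    rfl
  · rintro ⟨⟨i, j⟩, ⟨a, b⟩⟩ h
    simp only [Finset.mem_sigma, Finset.HasAntidiagonal.mem_antidiagonal] at h
    obtain ⟨-, rfl⟩ := h
    rfl
  · rintro ⟨⟨i, j⟩, ⟨a, b⟩⟩ h
    rfl

/-- Isolates the only two pairs in which the coefficient of index `k + 1` occurs. -/
theorem sum_antidiagonal_succ_eq {A : Type*} [AddCommMonoid A] (k : ℕ) (f : ℕ → ℕ → A) :
    ∑ p ∈ Finset.HasAntidiagonal.antidiagonal (k + 1), f p.1 p.2 = f 0 (k + 1) + f (k + 1) 0 +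
      ∑ p ∈ (Finset.HasAntidiagonal.antidiagonal (k + 1)).filter (fun p => 0 < p.1 ∧ 0 < p.2), f p.1 p.2 := by
  rw [← Finset.sum_filter_not_add_sum_filter _ (fun p : ℕ × ℕ => 0 < p.1 ∧ 0 < p.2)]
  congr 1
  have h : (Finset.HasAntidiagonal.antidiagonal (k + 1)).filter (fun p => ¬(0 < p.1 ∧ 0 < p.2)) =
      {(0, k + 1), (k + 1, 0)} := by
    ext ⟨i, j⟩
    simp only [Finset.mem_filter, Finset.HasAntidiagonal.mem_antidiagonal, Finset.mem_insert,
      Finset.mem_singleton, Prod.mk.injEq]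
    omega
  rw [h, Finset.sum_pair (by simp)]

end LowDegree

/-! ### The bracket of two multiderivations of degree one -/

section Multilinear

variable {Γ N : Type*} [AddCommGroup Γ] [Module ℝ Γ] [AddCommGroup N] [Module ℝ N] {r : ℕ}

theorem update_const_fin_one {α : Type*} (a b : α) :
    Function.update (fun _ : Fin 1 => a) 0 b = fun _ => b := by
  funext i
  rw [Subsingleton.elim i 0, Function.update_self]

/-- A block multilinear map of one block, as an alternating map. -/
def IsBlockMultilinear.toAlt {T : (Fin 1 → Fin r → Γ) → N} (h : IsBlockMultilinear T) :
    Γ [⋀^Fin r]→ₗ[ℝ] N where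
  toFun W := T fun _ => W
  map_update_add' := by
    intro _ W i x y
    obtain rfl : ‹DecidableEq (Fin r)› = instDecidableEqFin r := Subsingleton.elim _ _
    simpa only [update_const_fin_one] using h.map_add (fun _ => W) 0 i x y
  map_update_smul' := by
    intro _ W i t x
    obtain rfl : ‹DecidableEq (Fin r)› = instDecidableEqFin r := Subsingleton.elim _ _
    simpa only [update_const_fin_one] using h.map_smul (fun _ => W) 0 i t x
  map_eq_zero_of_eq' W i j hW hij := h.map_eq_zero (fun _ => W) 0 i j hij hW

theorem IsBlockMultilinear.toAlt_apply {T : (Fin 1 → Fin r → Γ) → N} (h : IsBlockMultilinear T)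
    (W : Fin r → Γ) : h.toAlt W = T fun _ => W := rfl

theorem isBlockMultilinear_of_alt (G : Γ [⋀^Fin r]→ₗ[ℝ] (Γ [⋀^Fin r]→ₗ[ℝ] N)) :
    IsBlockMultilinear fun X : Fin (1 + 1) → Fin r → Γ => G (X 0) (X 1) where
  map_add X i j a b := by
    fin_cases i <;> simp
  map_smul X i j t a := by
    fin_cases i <;> simp
  map_eq_zero X i j j' hj h := by
    fin_cases i
    · have h0 : G (X 0) = 0 := G.map_eq_zero_of_eq (X 0) h hj
      simp only [h0, AlternatingMap.zero_apply]
    · exact (G (X 0)).map_eq_zero_of_eq (X 1) h hj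

theorem isBlockMultilinear_ofAltTwo
    (D : Γ [⋀^Fin r]→ₗ[ℝ] (Γ [⋀^Fin r]→ₗ[ℝ] Module.End ℝ Γ)) :
    IsBlockMultilinear (ofAltTwo D) where
  map_add X i j a b := by
    funext z
    exact congrArg (fun T : Module.End ℝ Γ => T z) ((isBlockMultilinear_of_alt D).map_add X i j a b)
  map_smul X i j t a := by
    funext z
    exact congrArg (fun T : Module.End ℝ Γ => T z)
      ((isBlockMultilinear_of_alt D).map_smul X i j t a)
  map_eq_zero X i j j' hj h := by
    funext z
    exact congrArg (fun T : Module.End ℝ Γ => T z)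
      ((isBlockMultilinear_of_alt D).map_eq_zero X i j j' hj h)

/-- Skew symmetry of the block together with the last argument. -/
def IsSkew (a : Γ [⋀^Fin r]→ₗ[ℝ] Module.End ℝ Γ) : Prop := ∀ W j, a W (W j) = 0

/-- Polarization of the skew symmetry at the entry `u + W j`. -/
theorem IsSkew.update_swap {a : Γ [⋀^Fin r]→ₗ[ℝ] Module.End ℝ Γ} (ha : IsSkew a)
    (W : Fin r → Γ) (j : Fin r) (u : Γ) : a (Function.update W j u) (W j) = -a W u := by
  have h := ha (Function.update W j (u + W j)) j
  have h1 := ha (Function.update W j u) j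
  have h2 := ha W j
  simp only [Function.update_self, AlternatingMap.map_update_add, Function.update_eq_self, map_add,
    LinearMap.add_apply] at h h1
  rw [h1, h2, zero_add, add_zero] at h
  exact eq_neg_of_add_eq_zero_right h

theorem IsSkew.derivAlong_apply_self {a : Γ [⋀^Fin r]→ₗ[ℝ] Module.End ℝ Γ} (ha : IsSkew a)
    (T : Module.End ℝ Γ) (W : Fin r → Γ) (j : Fin r) :
    derivAlong a T W (W j) = -a W (T (W j)) := by
  rw [derivAlong_apply, LinearMap.sum_apply, Finset.sum_eq_single j, ha.update_swap]
  · intro s _ hs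
    have h := ha (Function.update W s (T (W s))) j
    rwa [Function.update_of_ne hs.symm] at h
  · simp

/-- On `Y j` the derivation term equals `-a Y (b X (Y j))` and cancels the product `a Y * b X`; the
other product vanishes by skewness. -/
theorem IsSkew.bracketAlt_apply_self {a b : Γ [⋀^Fin r]→ₗ[ℝ] Module.End ℝ Γ} (ha : IsSkew a)
    (hb : IsSkew b) (X Y : Fin r → Γ) (j : Fin r) : bracketAlt a b X Y (Y j) = 0 := by
  simp [bracketAlt_apply, circAlt_apply, ha.derivAlong_apply_self, hb.derivAlong_apply_self,
    ha Y j, hb Y j]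

end Multilinear

/-! ### Symbols of first order operators and of the bracket -/

section Symbols

variable {E : Type*} [NormedAddCommGroup E] [NormedSpace ℝ E]
  {M : Type*} [TopologicalSpace M] [ChartedSpace E M] [IsManifold 𝓘(ℝ, E) ∞ M]
  {F : Type*} [NormedAddCommGroup F] [NormedSpace ℝ F]
  {V : M → Type*} [∀ x, AddCommGroup (V x)] [∀ x, Module ℝ (V x)]
  [∀ x, TopologicalSpace (V x)] [TopologicalSpace (Bundle.TotalSpace F V)]
  [FiberBundle F V] [VectorBundle ℝ F V] {r : ℕ}

/-- `τ` is a symbol of the first order differential operator `T` on sections. -/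
def HasSymbol (T : Module.End ℝ (Sec E F V)) (τ : VectorFields E M) : Prop :=
  ∀ f z, T (fsmul f z) = fsmul f (T z) + fsmul (lieDerivFn τ f) z

theorem HasSymbol.apply {T : Module.End ℝ (Sec E F V)} {τ : VectorFields E M}
    (h : HasSymbol T τ) (f : SmoothFn E M) (z : Sec E F V) (x : M) :
    T (fsmul f z) x = f x • T z x + lieDeriv τ f x • z x := by
  rw [h f z]; rfl

theorem hasSymbol_of_apply {T : Module.End ℝ (Sec E F V)} {τ : VectorFields E M}
    (h : ∀ f z x, T (fsmul f z) x = f x • T z x + lieDeriv τ f x • z x) : HasSymbol T τ := by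
  intro f z
  ext x
  exact h f z x

theorem HasSymbol.add {S T : Module.End ℝ (Sec E F V)} {σ τ : VectorFields E M}
    (hS : HasSymbol S σ) (hT : HasSymbol T τ) : HasSymbol (S + T) (σ + τ) := by
  refine hasSymbol_of_apply fun f z x => ?_
  simp only [LinearMap.add_apply, ContMDiffSection.coe_add, Pi.add_apply, hS.apply, hT.apply,
    lieDeriv_add_left]
  module

theorem HasSymbol.neg {T : Module.End ℝ (Sec E F V)} {τ : VectorFields E M}
    (hT : HasSymbol T τ) : HasSymbol (-T) (-τ) := by
  refine hasSymbol_of_apply fun f z x => ?_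
  simp only [LinearMap.neg_apply, ContMDiffSection.coe_neg, Pi.neg_apply, hT.apply,
    lieDeriv_neg_left]
  module

theorem HasSymbol.sum {ι : Type*} (s : Finset ι) {T : ι → Module.End ℝ (Sec E F V)}
    {τ : ι → VectorFields E M} (h : ∀ i ∈ s, HasSymbol (T i) (τ i)) :
    HasSymbol (∑ i ∈ s, T i) (∑ i ∈ s, τ i) := by
  classical
  induction s using Finset.induction_on with
  | empty =>
    refine hasSymbol_of_apply fun f z x => ?_
    simp [lieDeriv_of_apply_eq_zero (0 : VectorFields E M) f (x := x) rfl]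
  | insert i s hi ih =>
    rw [Finset.sum_insert hi, Finset.sum_insert hi]
    exact (h i (Finset.mem_insert_self i s)).add
      (ih fun j hj => h j (Finset.mem_insert_of_mem hj))

/-- The mixed terms `σ(f) T z + τ(f) S z` are symmetric in the two operators and cancel, leaving the
commutator of derivations of `lieDeriv_vfBracket`. -/
theorem HasSymbol.commutator [CompleteSpace E] {S T : Module.End ℝ (Sec E F V)}
    {σ τ : VectorFields E M} (hS : HasSymbol S σ) (hT : HasSymbol T τ) :
    HasSymbol (S * T - T * S) (vfBracket σ τ) := by
  refine hasSymbol_of_apply fun f z x => ?_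
  simp only [LinearMap.sub_apply, Module.End.mul_apply, hS f z, hT f z, map_add,
    ContMDiffSection.coe_add, ContMDiffSection.coe_sub, Pi.sub_apply, Pi.add_apply, hS.apply,
    hT.apply, lieDerivFn_apply, lieDeriv_vfBracket]
  module

/-- `ρ` is a symbol of a cochain of degree `1`, given as an alternating map. -/
structure IsAltSymbol (a : Sec E F V [⋀^Fin r]→ₗ[ℝ] Module.End ℝ (Sec E F V))
    (ρ : Sec E F V [⋀^Fin r]→ₗ[ℝ] VectorFields E M) : Prop where
  fsmul : ∀ W j f, ρ (Function.update W j (fsmul f (W j))) = fsmul f (ρ W)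
  hasSymbol : ∀ W, HasSymbol (a W) (ρ W)

theorem IsAltSymbol.derivAlong {a : Sec E F V [⋀^Fin r]→ₗ[ℝ] Module.End ℝ (Sec E F V)}
    {ρ : Sec E F V [⋀^Fin r]→ₗ[ℝ] VectorFields E M} (h : IsAltSymbol a ρ)
    (T : Module.End ℝ (Sec E F V)) (W : Fin r → Sec E F V) :
    HasSymbol (derivAlong a T W) (derivAlong ρ T W) := by
  simp only [derivAlong_apply]
  exact HasSymbol.sum _ fun s _ => h.hasSymbol _

/-- The defect comes from the slot `s = j` alone, where `T` differentiates `f`. -/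
theorem derivAlong_update_fsmul {ρ : Sec E F V [⋀^Fin r]→ₗ[ℝ] VectorFields E M}
    (h : ∀ W j f, ρ (Function.update W j (fsmul f (W j))) = fsmul f (ρ W))
    {T : Module.End ℝ (Sec E F V)} {τ : VectorFields E M} (hT : HasSymbol T τ)
    (W : Fin r → Sec E F V) (j : Fin r) (f : SmoothFn E M) :
    derivAlong ρ T (Function.update W j (fsmul f (W j))) =
      fsmul f (derivAlong ρ T W) + fsmul (lieDerivFn τ f) (ρ W) := by
  have key : ∀ s, ρ (Function.update (Function.update W j (fsmul f (W j))) s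
      (T (Function.update W j (fsmul f (W j)) s))) =
      fsmul f (ρ (Function.update W s (T (W s)))) +
        if s = j then fsmul (lieDerivFn τ f) (ρ W) else 0 := by
    intro s
    split_ifs with hs
    · subst hs
      have h1 := h (Function.update W s (T (W s))) s f
      rw [Function.update_self, Function.update_idem] at h1
      rw [Function.update_self, Function.update_idem, hT f (W s), AlternatingMap.map_update_add,
        h1, h W s]
    · have h1 := h (Function.update W s (T (W s))) j f
      rw [Function.update_of_ne (Ne.symm hs)] at h1
      rw [Function.update_of_ne hs, Function.update_comm (Ne.symm hs), h1, add_zero]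
  have hsum : ∀ g : Fin r → VectorFields E M, ∑ s, fsmul f (g s) = fsmul f (∑ s, g s) := by
    intro g
    refine (map_sum (⟨⟨fsmul f, ?_⟩, fun Z Z' => ?_⟩ : VectorFields E M →+ VectorFields E M)
      g Finset.univ).symm
    · ext x; simp [fsmul]
    · ext x; simp [fsmul]
  simp only [derivAlong_apply, key, Finset.sum_add_distrib, hsum, Finset.sum_ite_eq',
    Finset.mem_univ, if_true]

variable [CompleteSpace E]

/-- The symbol of the bracket of two cochains of degree `1`. -/
noncomputable def bracketSymbol (a b : Sec E F V [⋀^Fin r]→ₗ[ℝ] Module.End ℝ (Sec E F V))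
    (ρ σ : Sec E F V [⋀^Fin r]→ₗ[ℝ] VectorFields E M) :
    Sec E F V [⋀^Fin r]→ₗ[ℝ] (Sec E F V [⋀^Fin r]→ₗ[ℝ] VectorFields E M) :=
  -((Filippov.derivAlong ρ).compAlternatingMap b + (Filippov.derivAlong σ).compAlternatingMap a -
    altPair vfBracket ρ σ - altPair vfBracket σ ρ)

theorem bracketSymbol_apply (a b : Sec E F V [⋀^Fin r]→ₗ[ℝ] Module.End ℝ (Sec E F V))
    (ρ σ : Sec E F V [⋀^Fin r]→ₗ[ℝ] VectorFields E M) (X Y : Fin r → Sec E F V) :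
    bracketSymbol a b ρ σ X Y = -(derivAlong ρ (b X) Y + derivAlong σ (a X) Y +
      -vfBracket (ρ X) (σ Y) + -vfBracket (σ X) (ρ Y)) := by
  rw [← sub_eq_add_neg, ← sub_eq_add_neg]; rfl

theorem IsAltSymbol.hasSymbol_bracketAlt
    {a b : Sec E F V [⋀^Fin r]→ₗ[ℝ] Module.End ℝ (Sec E F V)}
    {ρ σ : Sec E F V [⋀^Fin r]→ₗ[ℝ] VectorFields E M} (ha : IsAltSymbol a ρ)
    (hb : IsAltSymbol b σ) (X Y : Fin r → Sec E F V) :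
    HasSymbol (bracketAlt a b X Y) (bracketSymbol a b ρ σ X Y) := by
  rw [bracketAlt_apply_eq, bracketSymbol_apply]
  exact ((((ha.derivAlong _ _).add (hb.derivAlong _ _)).add
    ((ha.hasSymbol X).commutator (hb.hasSymbol Y)).neg).add
    ((hb.hasSymbol X).commutator (ha.hasSymbol Y)).neg).neg

/-- The defect `(σ X)(f) ρ Y` of `derivAlong ρ (b X)` is also that of the Lie bracket of `σ X` with
`ρ Y`, which enters with the opposite sign; likewise with `ρ` and `σ` exchanged. -/
theorem IsAltSymbol.bracketSymbol_fsmul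
    {a b : Sec E F V [⋀^Fin r]→ₗ[ℝ] Module.End ℝ (Sec E F V)}
    {ρ σ : Sec E F V [⋀^Fin r]→ₗ[ℝ] VectorFields E M} (ha : IsAltSymbol a ρ)
    (hb : IsAltSymbol b σ) (X Y : Fin r → Sec E F V) (j : Fin r) (f : SmoothFn E M) :
    bracketSymbol a b ρ σ X (Function.update Y j (Filippov.fsmul f (Y j))) =
      Filippov.fsmul f (bracketSymbol a b ρ σ X Y) := by
  simp only [bracketSymbol_apply, ha.fsmul, hb.fsmul, vfBracket_fsmul_right,
    derivAlong_update_fsmul ha.fsmul (hb.hasSymbol X),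
    derivAlong_update_fsmul hb.fsmul (ha.hasSymbol X)]
  ext x
  simp only [fsmul_apply, ContMDiffSection.coe_neg, ContMDiffSection.coe_add,
    Pi.neg_apply, Pi.add_apply]
  module

end Symbols

/-! ### Deformations -/

section Deformation

variable {E : Type*} [NormedAddCommGroup E] [NormedSpace ℝ E]
  {M : Type*} [TopologicalSpace M] [ChartedSpace E M] [IsManifold 𝓘(ℝ, E) ∞ M]
  {F : Type*} [NormedAddCommGroup F] [NormedSpace ℝ F]
  {V : M → Type*} [∀ x, AddCommGroup (V x)] [∀ x, Module ℝ (V x)]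
  [∀ x, TopologicalSpace (V x)] [TopologicalSpace (Bundle.TotalSpace F V)]
  [FiberBundle F V] [VectorBundle ℝ F V] {r : ℕ}

/-- A multiderivation of degree `1`, as an alternating map with values in endomorphisms. -/
def derAlt (φ : Der E F V r 1) : Sec E F V [⋀^Fin r]→ₗ[ℝ] Module.End ℝ (Sec E F V) :=
  have h : IsMultiderivation φ.1 := φ.2
  { toFun := fun W =>
      { toFun := φ.1 fun _ => W
        map_add' := h.map_add _
        map_smul' := h.map_smul _ }
    map_update_add' := fun W i x y =>
      LinearMap.ext fun z => congrFun (h.multilinear.toAlt.map_update_add W i x y) z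
    map_update_smul' := fun W i t x =>
      LinearMap.ext fun z => congrFun (h.multilinear.toAlt.map_update_smul W i t x) z
    map_eq_zero_of_eq' := fun W _ _ hW hij =>
      LinearMap.ext fun z => congrFun (h.multilinear.toAlt.map_eq_zero_of_eq W hW hij) z }

theorem ofAlt_derAlt (φ : Der E F V r 1) : ofAlt (derAlt φ) = φ.1 := by
  funext X z
  have h : (fun _ => X 0) = X := funext fun i => congrArg X (Subsingleton.elim 0 i)
  exact congrArg (fun Y => φ.1 Y z) h

theorem isSkew_derAlt (φ : Der E F V r 1) : IsSkew (derAlt φ) := fun W j =>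
  (φ.2 : IsMultiderivation φ.1).map_eq_zero (fun _ => W) 0 rfl j

theorem exists_isAltSymbol (φ : Der E F V r 1) : ∃ ρ, IsAltSymbol (derAlt φ) ρ := by
  obtain ⟨S, hS⟩ := (φ.2 : IsMultiderivation φ.1).exists_symbol
  refine ⟨hS.multilinear.toAlt, fun W j f => ?_, fun W => hasSymbol_of_apply fun f z x =>
    hS.leibniz (fun _ => W) f z x⟩
  simpa only [update_const_fin_one, IsBlockMultilinear.toAlt_apply] using hS.fsmul_last (fun _ => W) 0 rfl j f

theorem bracket_mem_der [CompleteSpace E] (φ ψ : Der E F V r 1) :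
    bracket φ.1 ψ.1 ∈ Der E F V r (1 + 1) := by
  obtain ⟨ρ, hρ⟩ := exists_isAltSymbol φ
  obtain ⟨σ, hσ⟩ := exists_isAltSymbol ψ
  rw [← ofAlt_derAlt φ, ← ofAlt_derAlt ψ, bracket_ofAlt]
  refine ⟨fun X => map_add _, fun X => map_smul _, isBlockMultilinear_ofAltTwo _, ?_,
    fun X => bracketSymbol (derAlt φ) (derAlt ψ) ρ σ (X 0) (X 1), isBlockMultilinear_of_alt _, ?_,
    fun X f z x => (hρ.hasSymbol_bracketAlt hσ (X 0) (X 1)).apply f z x⟩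
  · intro X i hi j
    obtain rfl : i = 1 := Fin.ext (by simpa using hi)
    exact (isSkew_derAlt φ).bracketAlt_apply_self (isSkew_derAlt ψ) (X 0) (X 1) j
  · intro X i hi j f
    obtain rfl : i = 1 := Fin.ext (by simpa using hi)
    simpa using hρ.bracketSymbol_fsmul hσ (X 0) (X 1) j f

theorem bracket_comm (φ ψ : Der E F V r 1) : bracket φ.1 ψ.1 = bracket ψ.1 φ.1 := by
  rw [← ofAlt_derAlt φ, ← ofAlt_derAlt ψ, bracket_ofAlt_comm]

theorem bracket_jacobi (a b c : Der E F V r 1) :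
    delta a (bracket b.1 c.1) + delta b (bracket c.1 a.1) + delta c (bracket a.1 b.1) = 0 := by
  have h := bracket_ofAlt_jacobi (derAlt a) (derAlt b) (derAlt c)
  rwa [ofAlt_derAlt, ofAlt_derAlt, ofAlt_derAlt] at h

/-- The coefficient of `t^m` in `[φ_t, φ_t]`. -/
noncomputable def bracketCoeff (c : ℕ → Der E F V r 1) (m : ℕ) : Cochain r (1 + 1) (Sec E F V) :=
  ∑ ij ∈ Finset.HasAntidiagonal.antidiagonal m, bracket (c ij.1).1 (c ij.2).1

/-- The identity `[φ_t, [φ_t, φ_t]] = 0`. -/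
theorem sum_delta_bracketCoeff (c : ℕ → Der E F V r 1) (m : ℕ) :
    ∑ p ∈ Finset.HasAntidiagonal.antidiagonal m, delta (c p.1) (bracketCoeff c p.2) = 0 := by
  set t : ℕ → ℕ → ℕ → Cochain r (1 + (1 + 1)) (Sec E F V) :=
    fun i a b => delta (c i) (bracket (c a).1 (c b).1) with ht
  have h1 := sum_antidiagonal_antidiagonal_rotate m t
  have h2 := sum_antidiagonal_antidiagonal_rotate m fun i a b => t a b i
  have hsum : ∑ p ∈ Finset.HasAntidiagonal.antidiagonal m,
      ∑ q ∈ Finset.HasAntidiagonal.antidiagonal p.2,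
        (t p.1 q.1 q.2 + t q.1 q.2 p.1 + t q.2 p.1 q.1) = 0 :=
    Finset.sum_eq_zero fun p _ => Finset.sum_eq_zero fun q _ => bracket_jacobi _ _ _
  simp only [Finset.sum_add_distrib, h1, h2] at hsum
  simp only [bracketCoeff, map_sum]
  -- The three rotated sums coincide, so Jacobi yields three times the wanted sum.
  have h3 : (3 : ℝ) • ∑ p ∈ Finset.HasAntidiagonal.antidiagonal m,
      ∑ q ∈ Finset.HasAntidiagonal.antidiagonal p.2, t p.1 q.1 q.2 = 0 := by
    rw [← hsum]; module
  exact (smul_eq_zero.1 h3).resolve_left (by norm_num)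

/-- In `[φ_t, [φ_t, φ_t]] = 0` at order `k + 1`, every term but `(0, k + 1)` contains a coefficient
that vanishes by hypothesis. -/
theorem delta_bracketCoeff_succ {c : ℕ → Der E F V r 1} {k : ℕ}
    (h : ∀ m ≤ k, bracketCoeff c m = 0) : delta (c 0) (bracketCoeff c (k + 1)) = 0 := by
  rw [← sum_delta_bracketCoeff c (k + 1), Finset.sum_eq_single (0, k + 1)]
  · rintro ⟨i, j⟩ hij hne
    rw [Finset.HasAntidiagonal.mem_antidiagonal] at hij
    have hj : j ≤ k := by
      by_contra hj
      simp only at hij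
      exact hne (by ext <;> simp <;> omega)
    simp only [h j hj, map_zero]
  · intro h0
    simp [Finset.HasAntidiagonal.mem_antidiagonal] at h0

theorem bracketCoeff_update_of_le (c : ℕ → Der E F V r 1) (ψ : Der E F V r 1) {k m : ℕ}
    (hm : m ≤ k) : bracketCoeff (Function.update c (k + 1) ψ) m = bracketCoeff c m := by
  refine Finset.sum_congr rfl fun p hp => ?_
  rw [Finset.HasAntidiagonal.mem_antidiagonal] at hp
  rw [Function.update_of_ne (by omega), Function.update_of_ne (by omega)]

/-- By symmetry of the bracket the two terms with `ψ` add up to `2 δψ`; the others make up `-2Θ`. -/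
theorem bracketCoeff_update_succ (c : ℕ → Der E F V r 1) (ψ : Der E F V r 1) (k : ℕ) :
    bracketCoeff (Function.update c (k + 1) ψ) (k + 1) =
      (2 : ℝ) • (delta (c 0) ψ.1 - obstruction k c) := by
  have h1 : bracketCoeff (Function.update c (k + 1) ψ) (k + 1) = _ :=
    sum_antidiagonal_succ_eq k fun i j =>
      bracket (Function.update c (k + 1) ψ i).1 (Function.update c (k + 1) ψ j).1
  have h2 : ∑ p ∈ (Finset.HasAntidiagonal.antidiagonal (k + 1)).filter
        (fun p => 0 < p.1 ∧ 0 < p.2),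
      bracket (Function.update c (k + 1) ψ p.1).1 (Function.update c (k + 1) ψ p.2).1 =
      ∑ p ∈ (Finset.HasAntidiagonal.antidiagonal (k + 1)).filter (fun p => 0 < p.1 ∧ 0 < p.2),
        bracket (c p.1).1 (c p.2).1 := by
    refine Finset.sum_congr rfl fun p hp => ?_
    rw [Finset.mem_filter, Finset.HasAntidiagonal.mem_antidiagonal] at hp
    rw [Function.update_of_ne (by omega), Function.update_of_ne (by omega)]
  have h3 : delta (c 0) ψ.1 = bracket (c 0).1 ψ.1 := rfl
  rw [h1, h2, Function.update_self, Function.update_of_ne (by omega), bracket_comm ψ (c 0), h3,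
    obstruction]
  module

theorem obstruction_mem_der [CompleteSpace E] (k : ℕ) (c : ℕ → Der E F V r 1) :
    obstruction k c ∈ Der E F V r (1 + 1) :=
  Submodule.smul_mem _ _ (Submodule.sum_mem _ fun _ _ => bracket_mem_der _ _)

theorem delta_obstruction {φ : Der E F V r 1} {k : ℕ} {c : ℕ → Der E F V r 1}
    (hc : IsDeformation φ k c) : delta φ (obstruction k c) = 0 := by
  -- The given `c (k + 1)` is arbitrary; replacing it by `0` makes the next coefficient exactly
  -- `-2Θ`.
  have h : delta (Function.update c (k + 1) 0 0)
      (bracketCoeff (Function.update c (k + 1) 0) (k + 1)) = 0 :=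
    delta_bracketCoeff_succ fun m hm =>
      (bracketCoeff_update_of_le c 0 hm).trans (hc.bracket_eq m hm)
  rw [bracketCoeff_update_succ, Function.update_of_ne (by omega), hc.zero, ZeroMemClass.coe_zero,
    map_zero, zero_sub, map_smul, map_neg] at h
  exact neg_eq_zero.1 ((smul_eq_zero.1 h).resolve_left (by norm_num))

theorem extends_iff {φ : Der E F V r 1} {k : ℕ} {c : ℕ → Der E F V r 1}
    (hc : IsDeformation φ k c) : Extends φ k c ↔ obstruction k c ∈ coboundaries φ 1 := by
  have key : ∀ ψ : Der E F V r 1, bracketCoeff (Function.update c (k + 1) ψ) (k + 1) = 0 ↔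
      delta φ ψ.1 = obstruction k c := by
    intro ψ
    rw [bracketCoeff_update_succ, hc.zero, smul_eq_zero, sub_eq_zero]
    norm_num
  constructor
  · rintro ⟨ψ, hψ⟩
    exact ⟨ψ.1, ψ.2, (key ψ).1 (hψ.bracket_eq (k + 1) le_rfl)⟩
  · rintro ⟨D, hD, h⟩
    refine ⟨⟨D, hD⟩, by rw [Function.update_of_ne (by omega), hc.zero], fun m hm => ?_⟩
    rcases Nat.le_succ_iff.1 hm with hm | rfl
    · exact (bracketCoeff_update_of_le c _ hm).trans (hc.bracket_eq m hm)
    · exact (key ⟨D, hD⟩).2 h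

end Deformation

end Filippov

theorem mainTheorem7
    {E : Type*} [NormedAddCommGroup E] [NormedSpace ℝ E] [FiniteDimensional ℝ E]
    {M : Type*} [TopologicalSpace M] [ChartedSpace E M] [IsManifold 𝓘(ℝ, E) ∞ M]
    [T2Space M] [SigmaCompactSpace M]
    {F : Type*} [NormedAddCommGroup F] [NormedSpace ℝ F] [FiniteDimensional ℝ F]
    {V : M → Type*} [∀ x, AddCommGroup (V x)] [∀ x, Module ℝ (V x)]
    [∀ x, TopologicalSpace (V x)] [TopologicalSpace (Bundle.TotalSpace F V)]
    [FiberBundle F V] [VectorBundle ℝ F V] [ContMDiffVectorBundle ∞ F V 𝓘(ℝ, E)]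
    (n : ℕ) (hn : 1 ≤ n)
    (φ : Filippov.Der E F V (n - 1) 1) (hφ : Filippov.bracket φ.1 φ.1 = 0)
    (k : ℕ) (c : ℕ → Filippov.Der E F V (n - 1) 1) (hc : Filippov.IsDeformation φ k c) :
    ∃ hΘ : Filippov.obstruction k c ∈ Filippov.cocycles φ (1 + 1),
      (Filippov.Extends φ k c ↔
        (Submodule.Quotient.mk ⟨Filippov.obstruction k c, hΘ⟩ : Filippov.Cohomology φ 1) = 0) := by

  -- Completeness of the model space is what `vfBracket` needs.
  have : CompleteSpace E := FiniteDimensional.complete ℝ E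
  refine ⟨⟨Filippov.obstruction_mem_der k c, Filippov.delta_obstruction hc⟩, ?_⟩
  rw [Filippov.extends_iff hc, Submodule.Quotient.mk_eq_zero]
  -- Membership in the comap along the inclusion of cocycles unfolds to membership in the
  -- coboundaries.
  rfl
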